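/- Let $V$ be a nonempty finite set, let $P=(P_{ij})_{i,j\in V}$ be an irreducible row-stochastic matrix, let $\lambda>0$, and let $(X_t)_{t\ge 0}$ be a $V$-valued process with arbitrary initial law and natural filtration $\mathcal F_t=\sigma(X_0,\dots,X_t)$. For $t\ge 0$ put $$L_t(i)=\sum_{s=0}^{t-1}\mathbf 1\{X_s=i\},\qquad N_t(i,j)=\sum_{s=0}^{t-1}\mathbf 1\{X_s=i,\,X_{s+1}=j\},\qquad \epsilon_t(i,j)=N_t(i,j)-L_t(i)P_{ij},$$ and assume that for all $t\ge0$ and $j\in V$, almost surely, $$\mathbb P(X_{t+1}=j\mid\mathcal F_t)=Q_t(X_t,j),\qquad Q_t(i,j)=\frac{P_{ij}e^{-\lambda\epsilon_t(i,j)}}{\sum_{k\in V}P_{ik}e^{-\lambda\epsilon_t(i,k)}}.$$ Let $\pi$ be the stationary distribution of $P$, let $\mathcal L=I-P^{\top}$ and $\Pi=\pi\mathbf 1^{\top}$. Then $\mathcal L+\Pi$ is invertible; let $\mathcal L^{\#}=(\mathcal L+\Pi)^{-1}-\Pi$ be the group inverse of $\mathcal L$ and let $\|\mathcal L^{\#}\|_{\infty\to\infty}$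 be its operator norm on $(\mathbb R^V,\|\cdot\|_\infty)$. Let $d_i=|\{j:P_{ij}>0\}|$, $d_{\max}=\max_i d_i$, $p_{\min}=\min\{P_{ij}:P_{ij}>0\}$, $$C_0=\log\Big(1+\frac{2}{p_{\min}}\Big),\qquad C_1=1-p_{\min}+\frac1\lambda\Big(\log d_{\max}+\lambda+\log 2+2\log\frac1{p_{\min}}\Big).$$ Fix $\delta>0$ and set $$\Lambda_t=\log\big(|V|(t+1)(t+2)^{1+\delta}\big),\qquad \alpha_t=\max\{1,\sqrt{\lambda\Lambda_t}\},$$ $$E_t=C_1+2\sqrt{\frac{\Lambda_t}{\lambda}}+\frac{C_0}{\alpha_t},\qquad A_t=\|\mathcal L^{\#}\|_{\infty\to\infty}\big(|V|(d_{\max}-1)E_t+1\big).$$ Then, almost surely, for all sufficiently large $t$: (i) $|L_t(i)-t\pi_i|\le A_t$ for every $i\in V$; (ii) $|N_t(i,j)-t\pi_iP_{ij}|\le P_{ij}A_t+(d_{\max}-1)E_t$ for every $(i,j)$ with $P_{ij}>0$; (iii) for every $f:V\to\mathbb R$, $$\Big|\frac1t\sum_{s=0}^{t-1}f(X_s)-\sum_{i\in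 V}\pi_if(i)\Big|\le\frac{\|f\|_\infty|V|}{t}A_t.$$ In particular, almost surely, as $t\to\infty$, $L_t(i)-t\pi_i=O(\sqrt{\log t})$ for every $i\in V$, $N_t(i,j)-t\pi_iP_{ij}=O(\sqrt{\log t})$ for every $(i,j)$ with $P_{ij}>0$, and $$\Big|\frac1t\sum_{s=0}^{t-1}f(X_s)-\sum_{i\in V}\pi_if(i)\Big|=O\Big(\frac{\sqrt{\log t}}{t}\Big)\qquad\text{for every } f:V\to\mathbb R.$$ -/

import Mathlib

open MeasureTheory Filter Asymptotics
open scoped ProbabilityTheory Matrix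

namespace TSAW

noncomputable section

/-! ### Counts along a trajectory -/

section Counts

variable {V : Type*} [DecidableEq V]

/-- `L_t(i)`: the number of departures from `i` strictly before time `t`. -/
def departures (x : ℕ → V) (t : ℕ) (i : V) : ℕ :=
  ((Finset.range t).filter fun s => x s = i).card

/-- `N_t(i,j)`: the number of traversals of the directed edge `(i,j)` up to time `t`. -/
def crossings (x : ℕ → V) (t : ℕ) (i j : V) : ℕ :=
  ((Finset.range t).filter fun s => x s = i ∧ x (s + 1) = j).card

/-- The edge discrepancy `ε_t(i,j) = N_t(i,j) - L_t(i) P_ij`. -/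
def edgeDiscrepancy (P : Matrix V V ℝ) (x : ℕ → V) (t : ℕ) (i j : V) : ℝ :=
  (crossings x t i j : ℝ) - (departures x t i : ℝ) * P i j

/-- The adaptive transition probability
`Q_t(i,j) = P_ij exp(-lam ε_t(i,j)) / ∑ k, P_ik exp(-lam ε_t(i,k))`. -/
def adaptiveKernel [Fintype V] (P : Matrix V V ℝ) (lam : ℝ) (x : ℕ → V) (t : ℕ) (i j : V) : ℝ :=
  P i j * Real.exp (-lam * edgeDiscrepancy P x t i j) /
    ∑ k, P i k * Real.exp (-lam * edgeDiscrepancy P x t i k)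

end Counts

/-! ### The process -/

section Walk

variable {Ω V : Type*}

/-- The `σ`-algebra `σ(X_0, …, X_t)`. -/
@[reducible] def history [MeasurableSpace V] (X : ℕ → Ω → V) (t : ℕ) : MeasurableSpace Ω :=
  ⨆ s ∈ Set.Iic t, MeasurableSpace.comap (X s) inferInstance

/-- `X` is a `V`-valued process (with arbitrary initial law) that follows the adaptive rule:
for every time `t` and state `j`, almost surely
`ℙ(X_{t+1} = j | σ(X_0, …, X_t)) = Q_t(X_t, j)`. -/
structure IsAdaptiveWalk [MeasurableSpace Ω] [Fintype V] [DecidableEq V] [MeasurableSpace V]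
    (μ : Measure Ω) (P : Matrix V V ℝ) (lam : ℝ) (X : ℕ → Ω → V) : Prop where
  measurable : ∀ t, Measurable (X t)
  rule : ∀ (t : ℕ) (j : V),
    μ⟦X (t + 1) ⁻¹' {j} | history X t⟧ =ᵐ[μ]
      fun ω => adaptiveKernel P lam (fun s => X s ω) t (X t ω) j

end Walk

/-! ### Quantities attached to the transition matrix -/

section MatrixQuantities

variable {V : Type*} [Fintype V]

/-- The out-degree `d_i`, the number of `j` with `P_ij > 0`. -/
def outDegree (P : Matrix V V ℝ) (i : V) : ℕ :=
  (Finset.univ.filter fun j => 0 < P i j).card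

/-- `d_max = max_i d_i`. -/
def maxOutDegree (P : Matrix V V ℝ) : ℕ :=
  Finset.univ.sup (outDegree P)

/-- `p_min`, the smallest positive entry of `P`. -/
def minEntry (P : Matrix V V ℝ) : ℝ :=
  ⨅ e : {e : V × V // 0 < P e.1 e.2}, P e.1.1 e.1.2

/-- `π` is a stationary distribution of `P`. -/
structure IsStationaryDistribution (P : Matrix V V ℝ) (π : V → ℝ) : Prop where
  mem_simplex : π ∈ stdSimplex ℝ V
  stationary : π ᵥ* P = π

/-- The rank-one matrix `Π = π 𝟏ᵀ`. -/
def stationaryProjection (π : V → ℝ) : Matrix V V ℝ :=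
  Matrix.vecMulVec π 1

/-- `ℒ = I - Pᵀ`. -/
def laplacian [DecidableEq V] (P : Matrix V V ℝ) : Matrix V V ℝ :=
  1 - Pᵀ

/-- The group inverse `ℒ^# = (ℒ + Π)⁻¹ - Π` of `ℒ = I - Pᵀ`. -/
def groupInverse [DecidableEq V] (P : Matrix V V ℝ) (π : V → ℝ) : Matrix V V ℝ :=
  (laplacian P + stationaryProjection π)⁻¹ - stationaryProjection π

/-- The operator norm `‖A‖_{∞→∞}`; the type `V → ℝ` carries the supremum norm. -/
def opNormInf (A : Matrix V V ℝ) : ℝ :=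
  ‖(Matrix.mulVecLin A).toContinuousLinearMap‖

end MatrixQuantities

/-! ### Explicit constants and bounds -/

section Bounds

variable {V : Type*} [Fintype V]

/-- `C_0 = log (1 + 2 / p_min)`. -/
def C₀ (P : Matrix V V ℝ) : ℝ :=
  Real.log (1 + 2 / minEntry P)

/-- `C_1 = 1 - p_min + (log d_max + lam + log 2 + 2 log (1 / p_min)) / lam`. -/
def C₁ (P : Matrix V V ℝ) (lam : ℝ) : ℝ :=
  1 - minEntry P +
    1 / lam * (Real.log (maxOutDegree P) + lam + Real.log 2 + 2 * Real.log (1 / minEntry P))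

variable (V) in
/-- `Λ_t = log (|V| (t+1) (t+2)^(1+δ))`. -/
def logTerm (δ : ℝ) (t : ℕ) : ℝ :=
  Real.log ((Fintype.card V : ℝ) * ((t : ℝ) + 1) * ((t : ℝ) + 2) ^ (1 + δ))

variable (V) in
/-- `α_t = max {1, √(lam Λ_t)}`. -/
def expParam (lam δ : ℝ) (t : ℕ) : ℝ :=
  max 1 (Real.sqrt (lam * logTerm V δ t))

/-- `C_1 + 2 √(Λ_t / lam) + C_0 / α_t`. -/
def envelope (P : Matrix V V ℝ) (lam δ : ℝ) (t : ℕ) : ℝ :=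
  C₁ P lam + 2 * Real.sqrt (logTerm V δ t / lam) + C₀ P / expParam V lam δ t

/-- `‖ℒ^#‖_{∞→∞} (|V| (d_max - 1) (C_1 + 2 √(Λ_t / lam) + C_0 / α_t) + 1)`. -/
def vertexBound [DecidableEq V] (P : Matrix V V ℝ) (π : V → ℝ) (lam δ : ℝ) (t : ℕ) : ℝ :=
  opNormInf (groupInverse P π) *
    ((Fintype.card V : ℝ) * ((maxOutDegree P : ℝ) - 1) * envelope P lam δ t + 1)

end Bounds

end

end TSAW

namespace TSAW

/-! ### Counting identities along a fixed trajectory. -/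

section Deterministic

variable {V : Type*} [DecidableEq V]

/-! The rule is self-correcting on each edge. The discrepancies of a row sum to zero, so some
positive-weight edge has ε ≤ 0; the normalizer of Q is then at least p_min, and Q_t(i,j) ≤ P_ij
e^{-λε_t(i,j)} / p_min (`adaptiveKernel_le`). Hence for α ≥ 1 the process e^{αε_t} drifts down above
the level a = (α + log(1/p_min))/λ, and its mean grows by at most e^{α(a+1-P_ij)} per step
(`IsAdaptiveWalk.integral_exp_succ_le`). A Chernoff bound with α = α_t, eventually √(λΛ_t), bounds
P(ε_t ≥ E_t) by (t+1)e^{-Λ_t} for large t. This is summable, so Borel–Cantelli gives ε_t(i,j) ≤ E_t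
eventually; zero row sums make the bound two-sided at the cost of d_max - 1.

The rest is linear algebra. Flow conservation says that ℒL_t is the divergence of ε_t plus a
boundary term of norm at most 1. As ℒ^#ℒ = I - Π and ΠL_t = tπ, applying ℒ^# bounds L_t - tπ; edge
counts and time averages follow from it. -/

theorem departures_zero (x : ℕ → V) (i : V) : departures x 0 i = 0 := by
  simp [departures]

theorem crossings_zero (x : ℕ → V) (i j : V) : crossings x 0 i j = 0 := by
  simp [crossings]

theorem departures_succ (x : ℕ → V) (t : ℕ) (i : V) :
    departures x (t + 1) i = departures x t i + if x t = i then 1 else 0 := by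
  simp only [departures, Finset.card_filter, Finset.sum_range_succ]

theorem crossings_succ (x : ℕ → V) (t : ℕ) (i j : V) :
    crossings x (t + 1) i j =
      crossings x t i j + if x t = i ∧ x (t + 1) = j then 1 else 0 := by
  simp only [crossings, Finset.card_filter, Finset.sum_range_succ]

theorem crossings_le (x : ℕ → V) (t : ℕ) (i j : V) : crossings x t i j ≤ t :=
  (Finset.card_filter_le _ _).trans (by simp)

theorem edgeDiscrepancy_zero (P : Matrix V V ℝ) (x : ℕ → V) (i j : V) :
    edgeDiscrepancy P x 0 i j = 0 := by
  simp [edgeDiscrepancy, departures_zero, crossings_zero]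

theorem edgeDiscrepancy_succ (P : Matrix V V ℝ) (x : ℕ → V) (t : ℕ) (i j : V) :
    edgeDiscrepancy P x (t + 1) i j = edgeDiscrepancy P x t i j +
      if x t = i then (if x (t + 1) = j then 1 else 0) - P i j else 0 := by
  simp only [edgeDiscrepancy, departures_succ, crossings_succ]
  split_ifs <;> simp_all <;> ring

theorem edgeDiscrepancy_le (P : Matrix V V ℝ) (hP : ∀ i j, 0 ≤ P i j)
    (x : ℕ → V) (t : ℕ) (i j : V) : edgeDiscrepancy P x t i j ≤ t := by
  have h1 : (crossings x t i j : ℝ) ≤ t := by exact_mod_cast crossings_le x t i j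
  have h2 : 0 ≤ (departures x t i : ℝ) * P i j := mul_nonneg (Nat.cast_nonneg _) (hP i j)
  simp only [edgeDiscrepancy]
  linarith

variable [Fintype V]

theorem sum_crossings_right (x : ℕ → V) (t : ℕ) (i : V) :
    ∑ j, crossings x t i j = departures x t i := by
  induction t with
  | zero => simp [departures_zero, crossings_zero]
  | succ t ih =>
    simp only [departures_succ, crossings_succ, Finset.sum_add_distrib, ih, ite_and]
    split_ifs <;> simp

/-- Both sides count the visits to j at times 0, …, t: each is the start or an arrival, and each is
followed by a departure or is the endpoint. -/
theorem sum_crossings_left (x : ℕ → V) (t : ℕ) (j : V) :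
    (∑ i, crossings x t i j) + (if x 0 = j then 1 else 0) =
      departures x t j + if x t = j then 1 else 0 := by
  induction t with
  | zero => simp [departures_zero, crossings_zero]
  | succ t ih =>
    have h : ∑ i, (if x t = i ∧ x (t + 1) = j then 1 else 0) =
        if x (t + 1) = j then 1 else 0 := by
      simp only [ite_and]
      simp
    simp only [departures_succ, crossings_succ, Finset.sum_add_distrib, h]
    omega

theorem sum_departures_mul (x : ℕ → V) (t : ℕ) (f : V → ℝ) :
    ∑ i, (departures x t i : ℝ) * f i = ∑ s ∈ Finset.range t, f (x s) := by
  induction t with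
  | zero => simp [departures_zero]
  | succ t ih =>
    simp only [departures_succ, Nat.cast_add, add_mul, Finset.sum_add_distrib, ih,
      Finset.sum_range_succ]
    simp

variable {P : Matrix V V ℝ}

theorem sum_edgeDiscrepancy (hP : P ∈ Matrix.rowStochastic ℝ V) (x : ℕ → V) (t : ℕ) (i : V) :
    ∑ j, edgeDiscrepancy P x t i j = 0 := by
  simp only [edgeDiscrepancy, Finset.sum_sub_distrib, ← Finset.mul_sum,
    Matrix.sum_row_of_mem_rowStochastic hP, ← Nat.cast_sum, sum_crossings_right]
  simp

/-- The conservation law for the visit counts: the Laplacian of the vector of departures is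
the divergence of the discrepancy up to the two end points of the trajectory. -/
theorem laplacian_mulVec_departures (P : Matrix V V ℝ) (x : ℕ → V) (t : ℕ) :
    laplacian P *ᵥ (fun i => (departures x t i : ℝ)) = fun j =>
      (∑ i, edgeDiscrepancy P x t i j) +
        ((if x 0 = j then 1 else 0) - if x t = j then 1 else 0) := by
  ext j
  have h : (∑ i, (crossings x t i j : ℝ)) + (if x 0 = j then 1 else 0) =
      departures x t j + if x t = j then 1 else 0 := by
    exact_mod_cast sum_crossings_left x t j
  simp only [laplacian, Matrix.sub_mulVec, Matrix.one_mulVec, Pi.sub_apply, edgeDiscrepancy,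
    Finset.sum_sub_distrib, Matrix.mulVec_transpose, Matrix.vecMul, dotProduct]
  linarith

/-- A row always contains an edge of positive weight whose discrepancy is nonpositive. -/
theorem exists_edgeDiscrepancy_nonpos (hP : P ∈ Matrix.rowStochastic ℝ V) (x : ℕ → V) (t : ℕ)
    (i : V) : ∃ k, 0 < P i k ∧ edgeDiscrepancy P x t i k ≤ 0 := by
  by_contra! hcon
  have hnn : ∀ k, 0 ≤ edgeDiscrepancy P x t i k := fun k => by
    rcases (hP.1 i k).eq_or_lt with h | h
    · simp [edgeDiscrepancy, ← h]
    · exact (hcon k h).le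
  obtain ⟨k, hk⟩ : ∃ k, 0 < P i k := by
    by_contra! h
    have := Matrix.sum_row_of_mem_rowStochastic hP i
    have h2 : ∑ k, P i k ≤ 0 := Finset.sum_nonpos fun k _ => h k
    linarith
  have := (Finset.sum_eq_zero_iff_of_nonneg fun k _ => hnn k).1 (sum_edgeDiscrepancy hP x t i) k
    (Finset.mem_univ k)
  exact (hcon k hk).ne' this

end Deterministic

/-! ### Row bounds, the group inverse, and control of the vertex counts. -/

section MatrixFacts

variable {V : Type*} [Fintype V] {P : Matrix V V ℝ}

theorem minEntry_le {i j : V} (h : 0 < P i j) : minEntry P ≤ P i j :=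
  ciInf_le (Set.finite_range _).bddBelow (⟨(i, j), h⟩ : {e : V × V // 0 < P e.1 e.2})

theorem outDegree_le_maxOutDegree (P : Matrix V V ℝ) (i : V) :
    outDegree P i ≤ maxOutDegree P :=
  Finset.le_sup (f := outDegree P) (Finset.mem_univ i)

theorem norm_mulVec_le (A : Matrix V V ℝ) (v : V → ℝ) : ‖A *ᵥ v‖ ≤ opNormInf A * ‖v‖ :=
  (Matrix.mulVecLin A).toContinuousLinearMap.le_opNorm v

variable [DecidableEq V]

theorem exists_entry_pos (hP : P ∈ Matrix.rowStochastic ℝ V) (i : V) : ∃ j, 0 < P i j := by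
  obtain ⟨k, hk, -⟩ := exists_edgeDiscrepancy_nonpos hP (fun _ => i) 0 i
  exact ⟨k, hk⟩

theorem minEntry_pos [Nonempty V] (hP : P ∈ Matrix.rowStochastic ℝ V) : 0 < minEntry P := by
  obtain ⟨j, hj⟩ := exists_entry_pos hP (Classical.arbitrary V)
  have : Nonempty {e : V × V // 0 < P e.1 e.2} := ⟨⟨(_, j), hj⟩⟩
  obtain ⟨e, he⟩ := exists_eq_ciInf_of_finite
    (f := fun e : {e : V × V // 0 < P e.1 e.2} => P e.1.1 e.1.2)
  rw [minEntry, ← he]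
  exact e.2

theorem minEntry_le_one [Nonempty V] (hP : P ∈ Matrix.rowStochastic ℝ V) : minEntry P ≤ 1 := by
  obtain ⟨j, hj⟩ := exists_entry_pos hP (Classical.arbitrary V)
  exact (minEntry_le hj).trans (Matrix.le_one_of_mem_rowStochastic hP)

theorem one_le_maxOutDegree [Nonempty V] (hP : P ∈ Matrix.rowStochastic ℝ V) :
    1 ≤ maxOutDegree P := by
  obtain ⟨j, hj⟩ := exists_entry_pos hP (Classical.arbitrary V)
  have : 0 < outDegree P (Classical.arbitrary V) := Finset.card_pos.2 ⟨j, by simpa using hj⟩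
  exact this.trans_le (outDegree_le_maxOutDegree P _)

/-- A one-sided bound on the discrepancies of a row turns into a two-sided one, as they sum
to zero. -/
theorem abs_edgeDiscrepancy_le (hP : P ∈ Matrix.rowStochastic ℝ V) {x : ℕ → V} {t : ℕ} {i : V}
    {E : ℝ} (hE : 0 ≤ E) (hzero : ∀ j, P i j = 0 → edgeDiscrepancy P x t i j = 0)
    (hle : ∀ j, 0 < P i j → edgeDiscrepancy P x t i j ≤ E) (j : V) :
    |edgeDiscrepancy P x t i j| ≤ ((maxOutDegree P : ℝ) - 1) * E := by
  have : Nonempty V := ⟨i⟩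
  have hd1 : (1 : ℝ) ≤ maxOutDegree P := by exact_mod_cast one_le_maxOutDegree hP
  rcases (hP.1 i j).eq_or_lt with h | h
  · rw [hzero j h.symm, abs_zero]
    exact mul_nonneg (by linarith) hE
  set D := Finset.univ.filter fun k => 0 < P i k
  have hj : j ∈ D := by simpa [D] using h
  have hsum : ∑ k ∈ D, edgeDiscrepancy P x t i k = 0 := by
    rw [← sum_edgeDiscrepancy hP x t i]
    refine Finset.sum_subset (Finset.subset_univ _) fun k _ hk => hzero k ?_
    exact le_antisymm (by simpa [D] using hk) (hP.1 i k)
  rw [← Finset.add_sum_erase _ _ hj] at hsum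
  have hrest : ∑ k ∈ D.erase j, edgeDiscrepancy P x t i k ≤ ((D.erase j).card : ℝ) * E := by
    rw [← nsmul_eq_mul]
    exact Finset.sum_le_card_nsmul _ _ _ fun k hk =>
      hle k (by simpa [D] using Finset.mem_of_mem_erase hk)
  have hcard : ((D.erase j).card : ℝ) + 1 ≤ maxOutDegree P := by
    have : D.card ≤ maxOutDegree P := outDegree_le_maxOutDegree P i
    rw [← Finset.card_erase_add_one hj] at this
    exact_mod_cast this
  have hlow : -(((maxOutDegree P : ℝ) - 1) * E) ≤ edgeDiscrepancy P x t i j := by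
    have : ((D.erase j).card : ℝ) * E ≤ ((maxOutDegree P : ℝ) - 1) * E := by
      gcongr
      linarith
    linarith
  refine abs_le.2 ⟨hlow, ?_⟩
  -- E ≤ (d_max - 1)E needs a second out-edge; if j is the only one, its discrepancy is zero.
  rcases (D.erase j).eq_empty_or_nonempty with he | he
  · rw [he, Finset.sum_empty, add_zero] at hsum
    rw [hsum]
    exact mul_nonneg (by linarith) hE
  · have : (1 : ℝ) ≤ (D.erase j).card := by exact_mod_cast he.card_pos
    nlinarith [hle j h]

/-- Maximum principle: at a maximizer m, h m is the P^k-average of h, so h equals h m wherever (P^k)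
m is positive, and irreducibility reaches every state. -/
theorem eq_of_mulVec_eq_self (hP : P ∈ Matrix.rowStochastic ℝ V) (hirr : P.IsIrreducible)
    {h : V → ℝ} (hh : P *ᵥ h = h) (i j : V) : h i = h j := by
  have : Nonempty V := ⟨i⟩
  obtain ⟨m, hm⟩ := Finite.exists_max h
  suffices H : ∀ j, h j = h m by rw [H i, H j]
  intro j
  obtain ⟨k, -, hk⟩ := (Matrix.isIrreducible_iff_exists_pow_pos hP.1).1 hirr m j
  have hPk : P ^ k ∈ Matrix.rowStochastic ℝ V := pow_mem hP k
  have hhk : P ^ k *ᵥ h = h := by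
    clear hk hPk
    induction k with
    | zero => simp
    | succ k ih => rw [pow_succ, ← Matrix.mulVec_mulVec, hh, ih]
  have h0 : ∑ l, (P ^ k) m l * (h m - h l) = 0 := by
    have := congrFun hhk m
    simp only [Matrix.mulVec, dotProduct] at this
    simp only [mul_sub, Finset.sum_sub_distrib, ← Finset.sum_mul,
      Matrix.sum_row_of_mem_rowStochastic hPk, this]
    ring
  have := (Finset.sum_eq_zero_iff_of_nonneg fun l _ =>
    mul_nonneg (hPk.1 m l) (sub_nonneg.2 (hm l))).1 h0 j (Finset.mem_univ j)
  rcases mul_eq_zero.1 this with h1 | h1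
  · exact absurd h1 hk.ne'
  · linarith

variable {π : V → ℝ}

/-- Transposing turns the kernel equation into h - Ph + (π·h)1 = 0. Pairing with π gives π·h = 0, so
h is harmonic, hence constant, with value π·h = 0. -/
theorem isUnit_laplacian_add_stationaryProjection (hP : P ∈ Matrix.rowStochastic ℝ V)
    (hirr : P.IsIrreducible) (hπ : IsStationaryDistribution P π) :
    IsUnit (laplacian P + stationaryProjection π) := by
  rw [← Matrix.isUnit_transpose, ← Matrix.mulVec_injective_iff_isUnit]
  refine (injective_iff_map_eq_zero
    (Matrix.mulVecLin (laplacian P + stationaryProjection π)ᵀ)).2 fun h hh => ?_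
  have hh' : h - P *ᵥ h + (π ⬝ᵥ h) • (1 : V → ℝ) = 0 := by
    rw [← hh]
    ext i
    rw [Matrix.mulVecLin_apply, laplacian, stationaryProjection, Matrix.transpose_add,
      Matrix.transpose_sub, Matrix.transpose_transpose, Matrix.transpose_one,
      Matrix.transpose_vecMulVec, Matrix.add_mulVec, Matrix.sub_mulVec, Matrix.one_mulVec,
      Matrix.vecMulVec_mulVec]
    simp
  have hsum : π ⬝ᵥ (1 : V → ℝ) = 1 := by simpa [dotProduct] using hπ.mem_simplex.2
  have hdot : π ⬝ᵥ h = 0 := by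
    have := congrArg (π ⬝ᵥ ·) hh'
    simpa [dotProduct_add, dotProduct_sub, Matrix.dotProduct_mulVec, hπ.stationary, hsum,
      dotProduct_smul] using this
  rw [hdot, zero_smul, add_zero, sub_eq_zero] at hh'
  ext i
  have : π ⬝ᵥ h = h i := by
    rw [show h = h i • (1 : V → ℝ) by
      ext j; simpa using eq_of_mulVec_eq_self hP hirr hh'.symm j i, dotProduct_smul, hsum]
    simp
  rw [← this, hdot, Pi.zero_apply]

/-- Follows from Πℒ = ℒΠ = 0 and Π² = Π: then (ℒ + Π)⁻¹ fixes Π. -/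
theorem groupInverse_mul_laplacian (hP : P ∈ Matrix.rowStochastic ℝ V)
    (hirr : P.IsIrreducible) (hπ : IsStationaryDistribution P π) :
    groupInverse P π * laplacian P = 1 - stationaryProjection π := by
  have hu := isUnit_laplacian_add_stationaryProjection hP hirr hπ
  have hsum : (1 : V → ℝ) ⬝ᵥ π = 1 := by simpa [dotProduct] using hπ.mem_simplex.2
  have h1 : stationaryProjection π * laplacian P = 0 := by
    rw [stationaryProjection, Matrix.vecMulVec_mul, laplacian, Matrix.vecMul_sub,
      Matrix.vecMul_transpose, hP.2]
    simp
  have h2 : laplacian P * stationaryProjection π = 0 := by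
    rw [stationaryProjection, Matrix.mul_vecMulVec, laplacian, Matrix.sub_mulVec,
      Matrix.mulVec_transpose, hπ.stationary]
    simp
  have h3 : stationaryProjection π * stationaryProjection π = stationaryProjection π := by
    rw [stationaryProjection, Matrix.vecMulVec_mul_vecMulVec, hsum, one_smul]
  have h4 : (laplacian P + stationaryProjection π)⁻¹ * stationaryProjection π =
      stationaryProjection π := by
    have h : (laplacian P + stationaryProjection π) * stationaryProjection π =
        stationaryProjection π := by rw [add_mul, h2, h3, zero_add]
    nth_rewrite 2 [← h]
    rw [← mul_assoc, Matrix.nonsing_inv_mul _ ((Matrix.isUnit_iff_isUnit_det _).1 hu), one_mul]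
  have h5 : laplacian P =
      (laplacian P + stationaryProjection π) - stationaryProjection π := by abel
  rw [groupInverse, sub_mul, h1, sub_zero]
  nth_rewrite 2 [h5]
  rw [mul_sub, Matrix.nonsing_inv_mul _ ((Matrix.isUnit_iff_isUnit_det _).1 hu), h4]

/-- Control of the visit counts by the discrepancies. -/
theorem abs_departures_sub_le (hP : P ∈ Matrix.rowStochastic ℝ V)
    (hirr : P.IsIrreducible) (hπ : IsStationaryDistribution P π) {x : ℕ → V} {t : ℕ} {B : ℝ}
    (hB : ∀ i j, |edgeDiscrepancy P x t i j| ≤ B) (i : V) :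
    |(departures x t i : ℝ) - t * π i| ≤
      opNormInf (groupInverse P π) * ((Fintype.card V : ℝ) * B + 1) := by
  have hB0 : 0 ≤ B := (abs_nonneg _).trans (hB i i)
  set L : V → ℝ := fun i => (departures x t i : ℝ)
  have hproj : stationaryProjection π *ᵥ L = fun i => t * π i := by
    have : (1 : V → ℝ) ⬝ᵥ L = t := by
      simpa [dotProduct, L] using sum_departures_mul x t (fun _ => 1)
    rw [stationaryProjection, Matrix.vecMulVec_mulVec, this]
    ext i
    simp [mul_comm]
  have hkey : groupInverse P π *ᵥ (laplacian P *ᵥ L) = fun i => L i - t * π i := by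
    rw [Matrix.mulVec_mulVec, groupInverse_mul_laplacian hP hirr hπ, Matrix.sub_mulVec,
      Matrix.one_mulVec, hproj]
    rfl
  have hnorm : ‖laplacian P *ᵥ L‖ ≤ (Fintype.card V : ℝ) * B + 1 := by
    rw [laplacian_mulVec_departures]
    refine (pi_norm_le_iff_of_nonneg (by positivity)).2 fun j => ?_
    refine (norm_add_le _ _).trans (add_le_add ?_ ?_)
    · refine (norm_sum_le _ _).trans ?_
      refine (Finset.sum_le_card_nsmul _ _ B fun k _ => hB k j).trans ?_
      simp
    · split_ifs <;> simp
  have := (norm_le_pi_norm (groupInverse P π *ᵥ (laplacian P *ᵥ L)) i).trans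
    ((norm_mulVec_le _ _).trans (mul_le_mul_of_nonneg_left hnorm (norm_nonneg _)))
  rwa [hkey] at this

end MatrixFacts

end TSAW

namespace TSAW

/-! ### One-step drift of the exponential of a discrepancy. -/

section DriftLevel

variable {V : Type*} {P : Matrix V V ℝ}

/-- The level above which the discrepancies have an exponential downward drift. -/
noncomputable def driftLevel (P : Matrix V V ℝ) (lam α : ℝ) : ℝ :=
  (α + Real.log (1 / minEntry P)) / lam

/-- The level is tuned so that the kernel bound P_ij e^{-λε} / p_min becomes P_ij e^{-α} there. -/
theorem exp_neg_mul_driftLevel (hp : 0 < minEntry P) {lam : ℝ} (hlam : 0 < lam) (α : ℝ) :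
    Real.exp (-lam * driftLevel P lam α) = Real.exp (-α) * minEntry P := by
  have : -lam * driftLevel P lam α = -α + Real.log (minEntry P) := by
    rw [driftLevel, one_div, Real.log_inv]
    field_simp
    ring
  rw [this, Real.exp_add, Real.exp_log hp]

end DriftLevel

section Kernel

variable {V : Type*} [Fintype V] [DecidableEq V] {P : Matrix V V ℝ}

theorem adaptiveKernel_le (hP : P ∈ Matrix.rowStochastic ℝ V) {lam : ℝ} (hlam : 0 < lam)
    (x : ℕ → V) (t : ℕ) (i j : V) :
    adaptiveKernel P lam x t i j ≤
      P i j * Real.exp (-lam * edgeDiscrepancy P x t i j) / minEntry P := by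
  have : Nonempty V := ⟨i⟩
  obtain ⟨k, hk, hε⟩ := exists_edgeDiscrepancy_nonpos hP x t i
  refine div_le_div_of_nonneg_left (mul_nonneg (hP.1 i j) (Real.exp_nonneg _))
    (minEntry_pos hP) ?_
  calc minEntry P ≤ P i k * 1 := by simpa using minEntry_le hk
    _ ≤ P i k * Real.exp (-lam * edgeDiscrepancy P x t i k) := by
      refine mul_le_mul_of_nonneg_left (Real.one_le_exp ?_) hk.le
      nlinarith
    _ ≤ _ := Finset.single_le_sum
      (f := fun k => P i k * Real.exp (-lam * edgeDiscrepancy P x t i k))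
      (fun l _ => mul_nonneg (hP.1 i l) (Real.exp_nonneg _)) (Finset.mem_univ k)

theorem adaptiveKernel_nonneg (hP : ∀ i j, 0 ≤ P i j) (lam : ℝ) (x : ℕ → V) (t : ℕ) (i j : V) :
    0 ≤ adaptiveKernel P lam x t i j :=
  div_nonneg (mul_nonneg (hP i j) (Real.exp_nonneg _))
    (Finset.sum_nonneg fun k _ => mul_nonneg (hP i k) (Real.exp_nonneg _))

theorem adaptiveKernel_le_one (hP : ∀ i j, 0 ≤ P i j) (lam : ℝ) (x : ℕ → V) (t : ℕ) (i j : V) :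
    adaptiveKernel P lam x t i j ≤ 1 :=
  div_le_one_of_le₀ (Finset.single_le_sum
      (f := fun k => P i k * Real.exp (-lam * edgeDiscrepancy P x t i k))
      (fun l _ => mul_nonneg (hP i l) (Real.exp_nonneg _)) (Finset.mem_univ j))
    (Finset.sum_nonneg fun k _ => mul_nonneg (hP i k) (Real.exp_nonneg _))

/-- The conditional increment of the exponential of the discrepancy is nonpositive above the
drift level and is bounded by a constant below it. -/
theorem exp_discrepancy_drift_le (hP : P ∈ Matrix.rowStochastic ℝ V) {lam : ℝ} (hlam : 0 < lam)
    {α : ℝ} (hα : 1 ≤ α) (x : ℕ → V) (t : ℕ) (i j : V) :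
    Real.exp (α * edgeDiscrepancy P x t i j) *
        ((Real.exp (-α * P i j) - 1) + (Real.exp (α * (1 - P i j)) - Real.exp (-α * P i j)) *
          adaptiveKernel P lam x t i j) ≤
      Real.exp (α * (driftLevel P lam α + 1 - P i j)) := by
  have : Nonempty V := ⟨i⟩
  have hp := minEntry_pos hP
  set ε := edgeDiscrepancy P x t i j
  set a := driftLevel P lam α
  set p := P i j
  set q := adaptiveKernel P lam x t i j
  have hp0 : 0 ≤ p := hP.1 i j
  have hq0 : 0 ≤ q := adaptiveKernel_nonneg hP.1 lam x t i j
  have hq1 : q ≤ 1 := adaptiveKernel_le_one hP.1 lam x t i j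
  have hexp : Real.exp (-α * p) ≤ Real.exp (α * (1 - p)) := Real.exp_le_exp.2 (by nlinarith)
  have hexp1 : Real.exp (-α * p) ≤ 1 := Real.exp_le_one_iff.2 (by nlinarith)
  rcases le_or_gt a ε with h | h
  · refine le_trans (mul_nonpos_of_nonneg_of_nonpos (Real.exp_nonneg _) ?_) (Real.exp_nonneg _)
    have hq : q ≤ p * Real.exp (-α) := by
      refine (adaptiveKernel_le hP hlam x t i j).trans ?_
      rw [div_le_iff₀ hp, mul_assoc, ← exp_neg_mul_driftLevel hp hlam]
      exact mul_le_mul_of_nonneg_left (Real.exp_le_exp.2 (by nlinarith)) hp0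
    have hmul : (Real.exp (α * (1 - p)) - Real.exp (-α * p)) * q ≤ Real.exp (-α * p) * p := by
      calc _ ≤ Real.exp (α * (1 - p)) * (p * Real.exp (-α)) := by
            refine mul_le_mul ?_ hq hq0 (Real.exp_nonneg _)
            linarith [Real.exp_pos (-α * p)]
        _ = Real.exp (-α * p) * p := by
            rw [mul_left_comm, ← Real.exp_add, mul_comm]
            ring_nf
    -- Here α ≥ 1 enters: 1 + p ≤ 1 + αp ≤ e^{αp}.
    have hone : Real.exp (-α * p) * (p + 1) ≤ 1 := by
      calc _ ≤ Real.exp (-α * p) * Real.exp (α * p) := by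
            refine mul_le_mul_of_nonneg_left ?_ (Real.exp_nonneg _)
            nlinarith [Real.add_one_le_exp (α * p)]
        _ = 1 := by rw [← Real.exp_add]; simp
    linarith
  -- Below the level no drift is needed: q ≤ 1 bounds the bracket by e^{α(1-p)}.
  · calc _ ≤ Real.exp (α * a) * Real.exp (α * (1 - p)) := by
          refine (mul_le_mul_of_nonneg_left (b := _) (c := Real.exp (α * (1 - p))) ?_
            (Real.exp_nonneg _)).trans
            (mul_le_mul_of_nonneg_right (Real.exp_le_exp.2 (by nlinarith)) (Real.exp_nonneg _))
          have := mul_le_of_le_one_right (sub_nonneg.2 hexp) hq1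
          linarith
      _ = _ := by rw [← Real.exp_add]; ring_nf

end Kernel

section Measurability

variable {Ω V : Type*} [MeasurableSpace Ω] [DecidableEq V] [MeasurableSpace V]
  [DiscreteMeasurableSpace V]

theorem measurable_edgeDiscrepancy (P : Matrix V V ℝ) {X : ℕ → Ω → V} {t : ℕ}
    (hX : ∀ s ≤ t, Measurable (X s)) (i j : V) :
    Measurable fun ω => edgeDiscrepancy P (fun s => X s ω) t i j := by
  induction t with
  | zero => simp only [edgeDiscrepancy_zero, measurable_const]
  | succ t ih =>
    simp only [edgeDiscrepancy_succ]
    refine (ih fun s hs => hX s (hs.trans t.le_succ)).add (Measurable.ite ?_ (Measurable.sub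
      (Measurable.ite ?_ measurable_const measurable_const) measurable_const) measurable_const)
    · exact hX t t.le_succ (MeasurableSet.of_discrete (s := {i}))
    · exact hX (t + 1) le_rfl (MeasurableSet.of_discrete (s := {j}))

end Measurability

section History

variable {Ω V : Type*} [MeasurableSpace V]

theorem measurable_history (X : ℕ → Ω → V) {s t : ℕ} (hst : s ≤ t) :
    Measurable[history X t] (X s) :=
  Measurable.of_comap_le (le_iSup₂_of_le s hst le_rfl)

variable [MeasurableSpace Ω] {μ : Measure Ω} [Fintype V] [DecidableEq V]
  {P : Matrix V V ℝ} {lam : ℝ} {X : ℕ → Ω → V}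

theorem IsAdaptiveWalk.history_le (hX : IsAdaptiveWalk μ P lam X) (t : ℕ) :
    history X t ≤ ‹MeasurableSpace Ω› :=
  iSup₂_le fun s _ => (hX.measurable s).comap_le

end History

/-! ### Exponential moments and tails of the discrepancies. -/

section Walk

variable {Ω V : Type*} [MeasurableSpace Ω] {μ : Measure Ω} [IsProbabilityMeasure μ]
  [Fintype V] [DecidableEq V] [MeasurableSpace V] [DiscreteMeasurableSpace V]
  {P : Matrix V V ℝ} {lam : ℝ} {X : ℕ → Ω → V}

/-- The transition rule tested against a bounded function of the past. -/
theorem IsAdaptiveWalk.integral_mul (hX : IsAdaptiveWalk μ P lam X) (t : ℕ) (j : V)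
    {f : Ω → ℝ} (hf : Measurable[history X t] f) {C : ℝ} (hC : ∀ ω, |f ω| ≤ C) :
    Integrable (fun ω => f ω * adaptiveKernel P lam (fun s => X s ω) t (X t ω) j) μ ∧
    ∫ ω, f ω * (if X (t + 1) ω = j then 1 else 0) ∂μ =
      ∫ ω, f ω * adaptiveKernel P lam (fun s => X s ω) t (X t ω) j ∂μ := by
  have hm := hX.history_le t
  set g : Ω → ℝ := (X (t + 1) ⁻¹' {j}).indicator fun _ => 1
  have hg : Integrable g μ := (integrable_const (1 : ℝ)).indicator
    (hX.measurable (t + 1) (MeasurableSet.of_discrete (s := {j})))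
  have hfg : Integrable (f * g) μ :=
    hg.bdd_mul (hf.mono hm le_rfl).aestronglyMeasurable (Filter.Eventually.of_forall hC)
  have hpull := condExp_mul_of_stronglyMeasurable_left (μ := μ) hf.stronglyMeasurable hfg hg
  have hae : μ[f * g | history X t] =ᵐ[μ]
      fun ω => f ω * adaptiveKernel P lam (fun s => X s ω) t (X t ω) j := by
    filter_upwards [hpull, hX.rule t j] with ω h1 h2
    rw [h1, Pi.mul_apply, h2]
  -- Integrability is inherited from the conditional expectation, so no separate measurability
  -- argument for the kernel is required.
  refine ⟨integrable_condExp.congr hae, ?_⟩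
  rw [← integral_congr_ae hae, integral_condExp hm]
  refine integral_congr_ae (Filter.Eventually.of_forall fun ω => ?_)
  by_cases h : X (t + 1) ω = j <;> simp [g, h]

/-- The kernel vanishes on such edges. Their discrepancies are then zero, so row sums reduce to
positive-weight edges. -/
theorem IsAdaptiveWalk.crossings_eq_zero (hX : IsAdaptiveWalk μ P lam X) {i j : V}
    (hij : P i j = 0) : ∀ᵐ ω ∂μ, ∀ t, crossings (fun s => X s ω) t i j = 0 := by
  have key : ∀ t, ∀ᵐ ω ∂μ, ¬ (X t ω = i ∧ X (t + 1) ω = j) := fun t => by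
    have hf : Measurable[history X t] fun ω => if X t ω = i then (1 : ℝ) else 0 :=
      Measurable.ite (measurable_history X le_rfl (MeasurableSet.of_discrete (s := {i})))
        measurable_const measurable_const
    have h := (hX.integral_mul t j hf (C := 1) fun ω => by split_ifs <;> simp).2
    have h0 : ∀ ω, (if X t ω = i then (1 : ℝ) else 0) *
        adaptiveKernel P lam (fun s => X s ω) t (X t ω) j = 0 := fun ω => by
      split_ifs with hi
      · simp [adaptiveKernel, hi, hij]
      · simp
    simp only [h0, integral_zero] at h
    rw [integral_eq_zero_iff_of_nonneg (fun ω => by positivity)] at h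
    · filter_upwards [h] with ω hω
      rintro ⟨h1, h2⟩
      simp [h1, h2] at hω
    · refine Integrable.of_bound (C := 1) (Measurable.aestronglyMeasurable ?_)
        (Filter.Eventually.of_forall fun ω => by split_ifs <;> simp)
      exact (hf.mono (hX.history_le t) le_rfl).mul (Measurable.ite
        (hX.measurable (t + 1) (MeasurableSet.of_discrete (s := {j})))
        measurable_const measurable_const)
  filter_upwards [ae_all_iff.2 key] with ω hω t
  induction t with
  | zero => exact crossings_zero _ _ _
  | succ t ih => rw [crossings_succ, ih, if_neg (hω t)]

theorem IsAdaptiveWalk.integrable_exp (hP : P ∈ Matrix.rowStochastic ℝ V)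
    (hX : IsAdaptiveWalk μ P lam X) {α : ℝ} (hα : 0 ≤ α) (t : ℕ) (i j : V) :
    Integrable (fun ω => Real.exp (α * edgeDiscrepancy P (fun s => X s ω) t i j)) μ := by
  refine Integrable.of_bound (C := Real.exp (α * t)) (Measurable.aestronglyMeasurable
    ((measurable_edgeDiscrepancy P (fun s _ => hX.measurable s) i j).const_mul α).exp)
    (Filter.Eventually.of_forall fun ω => ?_)
  rw [Real.norm_eq_abs, Real.abs_exp, Real.exp_le_exp]
  exact mul_le_mul_of_nonneg_left (edgeDiscrepancy_le P hP.1 _ t i j) hα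

theorem IsAdaptiveWalk.integral_exp_succ_le (hP : P ∈ Matrix.rowStochastic ℝ V)
    (hX : IsAdaptiveWalk μ P lam X) (hlam : 0 < lam) {α : ℝ} (hα : 1 ≤ α) (t : ℕ) (i j : V) :
    ∫ ω, Real.exp (α * edgeDiscrepancy P (fun s => X s ω) (t + 1) i j) ∂μ ≤
      ∫ ω, Real.exp (α * edgeDiscrepancy P (fun s => X s ω) t i j) ∂μ +
        Real.exp (α * (driftLevel P lam α + 1 - P i j)) := by
  have hα0 : 0 ≤ α := zero_le_one.trans hα
  set G : Ω → ℝ := fun ω => Real.exp (α * edgeDiscrepancy P (fun s => X s ω) t i j)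
  set f : Ω → ℝ := fun ω => if X t ω = i then G ω else 0
  set c : ℝ := Real.exp (α * (1 - P i j)) - Real.exp (-α * P i j)
  have hGint : Integrable G μ := hX.integrable_exp hP hα0 t i j
  have hf : Measurable[history X t] f :=
    Measurable.ite (measurable_history X le_rfl (MeasurableSet.of_discrete (s := {i})))
      (Measurable.exp (Measurable.const_mul (@measurable_edgeDiscrepancy Ω V (history X t) _ _ _
        P X t (fun s hs => measurable_history X hs) i j) α)) measurable_const
  have hfm : Measurable f := hf.mono (hX.history_le t) le_rfl
  have hC : ∀ ω, |f ω| ≤ Real.exp (α * t) := fun ω => by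
    simp only [f]
    split_ifs
    · rw [Real.abs_exp, Real.exp_le_exp]
      exact mul_le_mul_of_nonneg_left (edgeDiscrepancy_le P hP.1 _ t i j) hα0
    · simpa using Real.exp_nonneg _
  have hfint : Integrable f μ := Integrable.of_bound hfm.aestronglyMeasurable
    (Real.exp (α * t)) (Filter.Eventually.of_forall hC)
  obtain ⟨hQint, hQ⟩ := hX.integral_mul t j hf hC
  have hind : Integrable (fun ω => f ω * (if X (t + 1) ω = j then 1 else 0)) μ := by
    refine Integrable.of_bound (C := Real.exp (α * t)) (Measurable.aestronglyMeasurable ?_)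
      (Filter.Eventually.of_forall fun ω => ?_)
    · exact hfm.mul (Measurable.ite
        (hX.measurable (t + 1) (MeasurableSet.of_discrete (s := {j})))
        measurable_const measurable_const)
    · split_ifs
      · simpa using hC ω
      · simpa using Real.exp_nonneg _
  -- The increment vanishes unless X_t = i, and is affine in the indicator of X_{t+1} = j;
  -- integration can therefore replace that indicator by Q_t.
  have hstep : ∀ ω, Real.exp (α * edgeDiscrepancy P (fun s => X s ω) (t + 1) i j) =
      G ω + (f ω * (Real.exp (-α * P i j) - 1) +
        c * (f ω * (if X (t + 1) ω = j then 1 else 0))) := fun ω => by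
    rw [edgeDiscrepancy_succ, mul_add, Real.exp_add]
    simp only [f, G, c]
    split_ifs
    · ring
    · ring_nf
    · simp
    · simp
  have e1 : ∫ ω, (G ω + (f ω * (Real.exp (-α * P i j) - 1) +
        c * (f ω * (if X (t + 1) ω = j then 1 else 0)))) ∂μ =
      ∫ ω, G ω ∂μ + ∫ ω, (f ω * (Real.exp (-α * P i j) - 1) +
        c * (f ω * (if X (t + 1) ω = j then 1 else 0))) ∂μ :=
    integral_add hGint ((hfint.mul_const _).add (hind.const_mul _))
  have e2 : ∫ ω, (f ω * (Real.exp (-α * P i j) - 1) +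
        c * (f ω * (if X (t + 1) ω = j then 1 else 0))) ∂μ =
      ∫ ω, (f ω * (Real.exp (-α * P i j) - 1) +
        c * (f ω * adaptiveKernel P lam (fun s => X s ω) t (X t ω) j)) ∂μ := by
    rw [integral_add (hfint.mul_const _) (hind.const_mul _),
      integral_add (hfint.mul_const _) (hQint.const_mul _), integral_const_mul,
      integral_const_mul, hQ]
  rw [integral_congr_ae (Filter.Eventually.of_forall hstep), e1, e2]
  gcongr
  refine (integral_mono ((hfint.mul_const _).add (hQint.const_mul _)) (integrable_const
    (Real.exp (α * (driftLevel P lam α + 1 - P i j)))) fun ω => ?_).trans (by simp)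
  simp only [f, Pi.add_apply]
  split_ifs with h
  · refine le_trans (le_of_eq ?_)
      (exp_discrepancy_drift_le hP hlam hα (fun s => X s ω) t i j)
    rw [h]
    ring
  · simpa using Real.exp_nonneg _

theorem IsAdaptiveWalk.integral_exp_le (hP : P ∈ Matrix.rowStochastic ℝ V)
    (hX : IsAdaptiveWalk μ P lam X) (hlam : 0 < lam) {α : ℝ} (hα : 1 ≤ α) (t : ℕ) (i j : V) :
    ∫ ω, Real.exp (α * edgeDiscrepancy P (fun s => X s ω) t i j) ∂μ ≤
      (t + 1) * Real.exp (α * (driftLevel P lam α + 1 - P i j)) := by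
  have : Nonempty V := ⟨i⟩
  have hp := minEntry_pos hP
  induction t with
  | zero =>
    -- The initial value e^0 = 1 is at most one increment, whence the factor t + 1.
    have hlog : 0 ≤ Real.log (1 / minEntry P) :=
      Real.log_nonneg ((one_le_div hp).2 (minEntry_le_one hP))
    have ha : 0 ≤ driftLevel P lam α := div_nonneg (by linarith) hlam.le
    have := Matrix.le_one_of_mem_rowStochastic hP (i := i) (j := j)
    simp only [edgeDiscrepancy_zero]
    simpa using mul_nonneg (zero_le_one.trans hα) (by linarith)
  | succ t ih =>
    refine (hX.integral_exp_succ_le hP hlam hα t i j).trans ?_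
    push_cast
    linarith

theorem IsAdaptiveWalk.measureReal_le (hP : P ∈ Matrix.rowStochastic ℝ V)
    (hX : IsAdaptiveWalk μ P lam X) (hlam : 0 < lam) {α : ℝ} (hα : 1 ≤ α) (t : ℕ) (i j : V)
    (E : ℝ) :
    μ.real {ω | E ≤ edgeDiscrepancy P (fun s => X s ω) t i j} ≤
      (t + 1) * Real.exp (α * (driftLevel P lam α + 1 - P i j - E)) := by
  have h := ProbabilityTheory.measure_ge_le_exp_mul_mgf (μ := μ)
    (X := fun ω => edgeDiscrepancy P (fun s => X s ω) t i j) E (zero_le_one.trans hα)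
    (hX.integrable_exp hP (zero_le_one.trans hα) t i j)
  refine h.trans ((mul_le_mul_of_nonneg_left (hX.integral_exp_le hP hlam hα t i j)
    (Real.exp_nonneg _)).trans_eq ?_)
  rw [mul_left_comm, ← Real.exp_add]
  ring_nf

end Walk

end TSAW

namespace TSAW

/-! ### Growth of the envelope and the choice of the exponential parameter. -/

section Bounds

variable (V : Type*) [Fintype V] [Nonempty V] {δ : ℝ}

theorem logTerm_eq (δ : ℝ) (t : ℕ) :
    logTerm V δ t = Real.log (Fintype.card V) + Real.log (t + 1) + (1 + δ) * Real.log (t + 2) := by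
  have hV : (0 : ℝ) < Fintype.card V := by exact_mod_cast Fintype.card_pos
  rw [logTerm, Real.log_mul (by positivity) (by positivity), Real.log_mul hV.ne' (by positivity),
    Real.log_rpow (by positivity)]

theorem exp_neg_logTerm (δ : ℝ) (t : ℕ) :
    Real.exp (-logTerm V δ t) =
      ((Fintype.card V : ℝ) * ((t : ℝ) + 1) * ((t : ℝ) + 2) ^ (1 + δ))⁻¹ := by
  have hV : (0 : ℝ) < Fintype.card V := by exact_mod_cast Fintype.card_pos
  rw [logTerm, Real.exp_neg, Real.exp_log (by positivity)]

theorem tendsto_logTerm (hδ : 0 < δ) : Tendsto (logTerm V δ) atTop atTop := by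
  have hV : (1 : ℝ) ≤ Fintype.card V := by exact_mod_cast Fintype.card_pos
  refine tendsto_atTop_mono (fun t => ?_)
    (Real.tendsto_log_atTop.comp (tendsto_atTop_add_const_right atTop (1 : ℝ)
      tendsto_natCast_atTop_atTop))
  rw [logTerm_eq]
  have h1 : 0 ≤ Real.log (Fintype.card V) := Real.log_nonneg hV
  have h2 : 0 ≤ Real.log ((t : ℝ) + 2) :=
    Real.log_nonneg (by linarith [Nat.cast_nonneg (α := ℝ) t])
  have h3 : 0 ≤ (1 + δ) * Real.log ((t : ℝ) + 2) := mul_nonneg (by linarith) h2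
  simp only [Function.comp_apply]
  linarith

theorem tendsto_sqrt_log : Tendsto (fun t : ℕ => Real.sqrt (Real.log t)) atTop atTop :=
  Real.tendsto_sqrt_atTop.comp (Real.tendsto_log_atTop.comp tendsto_natCast_atTop_atTop)

theorem const_isBigO_sqrt_log (c : ℝ) :
    (fun _ : ℕ => c) =O[atTop] fun t : ℕ => Real.sqrt (Real.log t) :=
  (isLittleO_const_left.2 (.inr (tendsto_norm_atTop_atTop.comp tendsto_sqrt_log))).isBigO

theorem exists_logTerm_le (hδ : 0 < δ) :
    ∃ K, 0 ≤ K ∧ ∀ t : ℕ, 2 ≤ t → logTerm V δ t ≤ K * Real.log t := by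
  have hV : (1 : ℝ) ≤ Fintype.card V := by exact_mod_cast Fintype.card_pos
  have hl2 : 0 < Real.log 2 := Real.log_pos (by norm_num)
  have hlV : 0 ≤ Real.log (Fintype.card V) := Real.log_nonneg hV
  refine ⟨Real.log (Fintype.card V) / Real.log 2 + 2 + (1 + δ) * 2, by positivity,
    fun t ht => ?_⟩
  have ht' : (2 : ℝ) ≤ t := by exact_mod_cast ht
  have hlt : Real.log 2 ≤ Real.log t := Real.log_le_log (by norm_num) ht'
  have h2 : Real.log ((t : ℝ) + 2) ≤ 2 * Real.log t := by
    -- For t ≥ 2 one has t + 2 ≤ t².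
    rw [← Nat.cast_two, ← Real.log_pow]
    exact Real.log_le_log (by positivity) (by push_cast; nlinarith)
  have h1 : Real.log ((t : ℝ) + 1) ≤ 2 * Real.log t :=
    (Real.log_le_log (by positivity) (by linarith)).trans h2
  have h0 : Real.log (Fintype.card V) ≤ Real.log (Fintype.card V) / Real.log 2 * Real.log t := by
    rw [div_mul_eq_mul_div, le_div_iff₀ hl2]
    exact mul_le_mul_of_nonneg_left hlt hlV
  have h3 : (1 + δ) * Real.log ((t : ℝ) + 2) ≤ (1 + δ) * (2 * Real.log t) :=
    mul_le_mul_of_nonneg_left h2 (by linarith)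
  rw [logTerm_eq]
  linarith

theorem sqrt_logTerm_isBigO (hδ : 0 < δ) {lam : ℝ} (hlam : 0 < lam) :
    (fun t : ℕ => Real.sqrt (logTerm V δ t / lam)) =O[atTop]
      fun t : ℕ => Real.sqrt (Real.log t) := by
  obtain ⟨K, hK, h⟩ := exists_logTerm_le V hδ
  refine IsBigO.of_bound (Real.sqrt (K / lam)) ?_
  filter_upwards [eventually_ge_atTop 2] with t ht
  rw [Real.norm_of_nonneg (Real.sqrt_nonneg _), Real.norm_of_nonneg (Real.sqrt_nonneg _),
    ← Real.sqrt_mul (by positivity), div_mul_eq_mul_div]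
  have := h t ht
  gcongr

variable {V}

theorem C₀_nonneg [DecidableEq V] {P : Matrix V V ℝ} (hP : P ∈ Matrix.rowStochastic ℝ V) :
    0 ≤ C₀ P := by
  have := minEntry_pos hP
  have : 0 ≤ 2 / minEntry P := by positivity
  exact Real.log_nonneg (by linarith)

variable [DecidableEq V] {P : Matrix V V ℝ} {lam : ℝ}

/-- These are the terms of C₁ that cancel 1 - P_ij and the constant part of the drift level in the
tail exponent. -/
theorem C₁_ge (hP : P ∈ Matrix.rowStochastic ℝ V) (hlam : 0 < lam) :
    1 - minEntry P + Real.log (1 / minEntry P) / lam ≤ C₁ P lam := by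
  have hp := minEntry_pos hP
  have hd : 0 ≤ Real.log (maxOutDegree P) :=
    Real.log_nonneg (by exact_mod_cast one_le_maxOutDegree hP)
  have hl2 : 0 ≤ Real.log 2 := Real.log_nonneg (by norm_num)
  have hlog : 0 ≤ Real.log (1 / minEntry P) :=
    Real.log_nonneg ((one_le_div hp).2 (minEntry_le_one hP))
  rw [C₁, one_div_mul_eq_div]
  gcongr
  linarith

theorem envelope_nonneg (hP : P ∈ Matrix.rowStochastic ℝ V) (hlam : 0 < lam) (δ : ℝ) (t : ℕ) :
    0 ≤ envelope P lam δ t := by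
  have hlog : 0 ≤ Real.log (1 / minEntry P) :=
    Real.log_nonneg ((one_le_div (minEntry_pos hP)).2 (minEntry_le_one hP))
  have h1 : 0 ≤ C₁ P lam := le_trans
    (add_nonneg (sub_nonneg.2 (minEntry_le_one hP)) (div_nonneg hlog hlam.le)) (C₁_ge hP hlam)
  have h2 : 0 ≤ C₀ P / expParam V lam δ t :=
    div_nonneg (C₀_nonneg hP) (zero_le_one.trans (le_max_left _ _))
  have h3 := Real.sqrt_nonneg (logTerm V δ t / lam)
  rw [envelope]
  linarith

theorem envelope_isBigO (hP : P ∈ Matrix.rowStochastic ℝ V) (hlam : 0 < lam) (hδ : 0 < δ) :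
    envelope P lam δ =O[atTop] fun t : ℕ => Real.sqrt (Real.log t) := by
  refine ((const_isBigO_sqrt_log (C₁ P lam)).add
    ((sqrt_logTerm_isBigO V hδ hlam).const_mul_left 2)).add
    (IsBigO.trans (IsBigO.of_bound 1 (Eventually.of_forall fun t => ?_))
      (const_isBigO_sqrt_log (C₀ P)))
  have h1 : 1 ≤ expParam V lam δ t := le_max_left _ _
  have h0 := C₀_nonneg hP
  rw [one_mul, Real.norm_of_nonneg h0, Real.norm_of_nonneg (by positivity)]
  exact div_le_self h0 h1

theorem vertexBound_isBigO (hP : P ∈ Matrix.rowStochastic ℝ V) (hlam : 0 < lam) (hδ : 0 < δ)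
    (π : V → ℝ) :
    vertexBound P π lam δ =O[atTop] fun t : ℕ => Real.sqrt (Real.log t) :=
  (((envelope_isBigO hP hlam hδ).const_mul_left _).add (const_isBigO_sqrt_log 1)).const_mul_left _

/-- The choice of the envelope: the exponent of the tail bound is at most `-logTerm V δ t`. -/
theorem exponent_le (hP : P ∈ Matrix.rowStochastic ℝ V) (hlam : 0 < lam) {t : ℕ}
    (ht : 1 ≤ lam * logTerm V δ t) {i j : V} (hij : 0 < P i j) :
    expParam V lam δ t *
        (driftLevel P lam (expParam V lam δ t) + 1 - P i j - envelope P lam δ t) ≤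
      -logTerm V δ t := by
  set Λ := logTerm V δ t
  have hα : expParam V lam δ t = Real.sqrt (lam * Λ) := max_eq_right (Real.one_le_sqrt.2 ht)
  have hα1 : 1 ≤ expParam V lam δ t := le_max_left _ _
  have hC₀ : 0 ≤ C₀ P / expParam V lam δ t := div_nonneg (C₀_nonneg hP) (by linarith)
  rw [envelope]
  set α := expParam V lam δ t
  have hsq : α ^ 2 = lam * Λ := by rw [hα, Real.sq_sqrt (by linarith)]
  have hsqrt : Real.sqrt (Λ / lam) = α / lam := by
    rw [Real.sqrt_eq_iff_mul_self_eq_of_pos (by positivity), ← sq, div_pow, hsq]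
    field_simp
  have hpij := minEntry_le hij
  have hC₁ := C₁_ge hP hlam
  have hdrift : driftLevel P lam α = α / lam + Real.log (1 / minEntry P) / lam := by
    rw [driftLevel, add_div]
  -- The drift level contributes α/λ and the envelope subtracts 2α/λ; the remaining terms are
  -- nonpositive.
  calc _ ≤ α * -(α / lam) := by
        refine mul_le_mul_of_nonneg_left ?_ (by linarith)
        change _ - (C₁ P lam + 2 * Real.sqrt (Λ / lam) + _) ≤ _
        rw [hsqrt, hdrift]
        linarith
    _ = -Λ := by
        rw [mul_neg, mul_div_assoc', ← sq, hsq]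
        field_simp

end Bounds

/-! ### Borel–Cantelli and the almost sure bounds. -/

section Walk

variable {Ω V : Type*} [MeasurableSpace Ω] {μ : Measure Ω} [IsProbabilityMeasure μ]
  [Fintype V] [DecidableEq V] [MeasurableSpace V] [DiscreteMeasurableSpace V]
  {P : Matrix V V ℝ} {lam δ : ℝ} {X : ℕ → Ω → V}

theorem IsAdaptiveWalk.eventually_edgeDiscrepancy_le (hP : P ∈ Matrix.rowStochastic ℝ V)
    (hX : IsAdaptiveWalk μ P lam X) (hlam : 0 < lam) (hδ : 0 < δ) {i j : V} (hij : 0 < P i j) :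
    ∀ᵐ ω ∂μ, ∀ᶠ t : ℕ in atTop,
      edgeDiscrepancy P (fun s => X s ω) t i j ≤ envelope P lam δ t := by
  have : Nonempty V := ⟨i⟩
  have hV : (1 : ℝ) ≤ Fintype.card V := by exact_mod_cast Fintype.card_pos
  set S : ℕ → Set Ω := fun t =>
    {ω | envelope P lam δ t ≤ edgeDiscrepancy P (fun s => X s ω) t i j}
  have hsum : Summable fun t : ℕ => 1 / ((t : ℝ) + 2) ^ (1 + δ) := by
    have := (summable_nat_add_iff 2).2 (Real.summable_one_div_nat_rpow.2 (by linarith : 1 < 1 + δ))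
    simpa using this
  have hS : Summable fun t => μ.real (S t) := by
    refine Summable.of_norm_bounded_eventually_nat hsum ?_
    filter_upwards [(tendsto_logTerm V hδ).eventually_ge_atTop (1 / lam)] with t ht
    have ht' : 1 ≤ lam * logTerm V δ t := by rwa [div_le_iff₀' hlam] at ht
    rw [Real.norm_of_nonneg measureReal_nonneg]
    refine (hX.measureReal_le hP hlam (le_max_left _ _ : 1 ≤ expParam V lam δ t) t i j _).trans ?_
    refine (mul_le_mul_of_nonneg_left (Real.exp_le_exp.2 (exponent_le hP hlam ht' hij))
      (by positivity)).trans ?_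
    -- The factor t + 1 of the moment bound cancels against e^{-Λ_t}, leaving 1/(|V|(t+2)^{1+δ});
    -- |V| ≥ 1 is then dropped.
    rw [exp_neg_logTerm, ← div_eq_mul_inv, div_le_div_iff₀ (by positivity) (by positivity)]
    have : (0 : ℝ) ≤ (t + 1) * (t + 2) ^ (1 + δ) := by positivity
    nlinarith
  have hne : ∑' t, μ (S t) ≠ ⊤ := by
    simpa [ofReal_measureReal] using hS.tsum_ofReal_ne_top
  filter_upwards [ae_eventually_notMem hne] with ω hω
  exact hω.mono fun t ht => (not_le.1 ht).le

theorem IsAdaptiveWalk.eventually_abs_edgeDiscrepancy_le (hP : P ∈ Matrix.rowStochastic ℝ V)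
    (hX : IsAdaptiveWalk μ P lam X) (hlam : 0 < lam) (hδ : 0 < δ) :
    ∀ᵐ ω ∂μ, ∀ᶠ t : ℕ in atTop, ∀ i j : V,
      |edgeDiscrepancy P (fun s => X s ω) t i j| ≤
        ((maxOutDegree P : ℝ) - 1) * envelope P lam δ t := by
  have h1 : ∀ᵐ ω ∂μ, ∀ i j, P i j = 0 → ∀ t, crossings (fun s => X s ω) t i j = 0 := by
    simp only [ae_all_iff]
    intro i j hij
    simpa only [ae_all_iff] using hX.crossings_eq_zero hij
  have h2 : ∀ᵐ ω ∂μ, ∀ i j, 0 < P i j → ∀ᶠ t : ℕ in atTop,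
      edgeDiscrepancy P (fun s => X s ω) t i j ≤ envelope P lam δ t := by
    simp only [ae_all_iff]
    exact fun i j hij => hX.eventually_edgeDiscrepancy_le hP hlam hδ hij
  filter_upwards [h1, h2] with ω hω1 hω2
  -- Finiteness of V gives one threshold time for all edges.
  have h3 : ∀ᶠ t : ℕ in atTop, ∀ i j, 0 < P i j →
      edgeDiscrepancy P (fun s => X s ω) t i j ≤ envelope P lam δ t := by
    simpa only [eventually_all] using hω2
  filter_upwards [h3] with t ht i j
  have : Nonempty V := ⟨i⟩
  refine abs_edgeDiscrepancy_le hP (envelope_nonneg hP hlam δ t) (fun j hij => ?_) (ht i) j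
  simp [edgeDiscrepancy, hω1 i j hij, hij]

theorem IsAdaptiveWalk.eventually_bounds (hP : P ∈ Matrix.rowStochastic ℝ V)
    (hirr : P.IsIrreducible) (hX : IsAdaptiveWalk μ P lam X) (hlam : 0 < lam) {π : V → ℝ}
    (hπ : IsStationaryDistribution P π) (hδ : 0 < δ) :
    ∀ᵐ ω ∂μ, ∀ᶠ t : ℕ in atTop,
      (∀ i : V, |(departures (fun s => X s ω) t i : ℝ) - t * π i| ≤ vertexBound P π lam δ t) ∧
      (∀ i j : V,
        |(crossings (fun s => X s ω) t i j : ℝ) - t * π i * P i j|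
          ≤ P i j * vertexBound P π lam δ t
            + ((maxOutDegree P : ℝ) - 1) * envelope P lam δ t) ∧
      (∀ f : V → ℝ,
        |1 / (t : ℝ) * ∑ s ∈ Finset.range t, f (X s ω) - ∑ i, π i * f i|
          ≤ ‖f‖ * (Fintype.card V : ℝ) / t * vertexBound P π lam δ t) := by
  filter_upwards [hX.eventually_abs_edgeDiscrepancy_le hP hlam hδ] with ω hω
  filter_upwards [hω, eventually_gt_atTop 0] with t ht htpos
  have hdep : ∀ i : V, |(departures (fun s => X s ω) t i : ℝ) - t * π i| ≤
      vertexBound P π lam δ t := fun i => by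
    rw [vertexBound, mul_assoc]
    exact abs_departures_sub_le hP hirr hπ ht i
  refine ⟨hdep, fun i j => ?_, fun f => ?_⟩
  · have hsplit : (crossings (fun s => X s ω) t i j : ℝ) - t * π i * P i j =
        P i j * ((departures (fun s => X s ω) t i : ℝ) - t * π i) +
          edgeDiscrepancy P (fun s => X s ω) t i j := by
      rw [edgeDiscrepancy]
      ring
    rw [hsplit]
    refine (abs_add_le _ _).trans (add_le_add ?_ (ht i j))
    rw [abs_mul, abs_of_nonneg (hP.1 i j)]
    exact mul_le_mul_of_nonneg_left (hdep i) (hP.1 i j)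
  · have ht0 : (0 : ℝ) < t := by exact_mod_cast htpos
    have hsplit : 1 / (t : ℝ) * ∑ s ∈ Finset.range t, f (X s ω) - ∑ i, π i * f i =
        1 / t * ∑ i, ((departures (fun s => X s ω) t i : ℝ) - t * π i) * f i := by
      rw [← sum_departures_mul (fun s => X s ω)]
      simp only [sub_mul, Finset.sum_sub_distrib, mul_sub, mul_assoc, ← Finset.mul_sum]
      field_simp
    have hbound : |∑ i, ((departures (fun s => X s ω) t i : ℝ) - t * π i) * f i| ≤
        Fintype.card V * (vertexBound P π lam δ t * ‖f‖) := by
      refine (Finset.abs_sum_le_sum_abs _ _).trans ((Finset.sum_le_card_nsmul _ _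
        (vertexBound P π lam δ t * ‖f‖) fun i _ => ?_).trans (by simp))
      rw [abs_mul]
      exact mul_le_mul (hdep i) (norm_le_pi_norm f i) (abs_nonneg _)
        ((abs_nonneg _).trans (hdep i))
    rw [hsplit, abs_mul, abs_of_pos (by positivity)]
    refine (mul_le_mul_of_nonneg_left hbound (by positivity)).trans_eq ?_
    ring

end Walk

end TSAW

/-! ### The main theorem. -/

theorem mainTheorem1
    {Ω V : Type*} [MeasurableSpace Ω] (μ : Measure Ω) [IsProbabilityMeasure μ]
    [Fintype V] [DecidableEq V] [MeasurableSpace V] [DiscreteMeasurableSpace V]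
    (P : Matrix V V ℝ) (hP : P ∈ Matrix.rowStochastic ℝ V) (hirr : P.IsIrreducible)
    (lam : ℝ) (hlam : 0 < lam)
    (X : ℕ → Ω → V) (hX : TSAW.IsAdaptiveWalk μ P lam X)
    (π : V → ℝ) (hπ : TSAW.IsStationaryDistribution P π)
    (δ : ℝ) (hδ : 0 < δ) :
    IsUnit (TSAW.laplacian P + TSAW.stationaryProjection π) ∧
    (∀ᵐ ω ∂μ, ∀ᶠ t : ℕ in atTop,
      (∀ i : V,
        |(TSAW.departures (fun s => X s ω) t i : ℝ) - t * π i|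
          ≤ TSAW.vertexBound P π lam δ t) ∧
      (∀ i j : V, 0 < P i j →
        |(TSAW.crossings (fun s => X s ω) t i j : ℝ) - t * π i * P i j|
          ≤ P i j * TSAW.vertexBound P π lam δ t
            + ((TSAW.maxOutDegree P : ℝ) - 1) * TSAW.envelope P lam δ t) ∧
      (∀ f : V → ℝ,
        |1 / (t : ℝ) * ∑ s ∈ Finset.range t, f (X s ω) - ∑ i, π i * f i|
          ≤ ‖f‖ * (Fintype.card V : ℝ) / t * TSAW.vertexBound P π lam δ t)) ∧
    (∀ᵐ ω ∂μ,
      (∀ i : V,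
        (fun t : ℕ => (TSAW.departures (fun s => X s ω) t i : ℝ) - t * π i)
          =O[atTop] fun t : ℕ => Real.sqrt (Real.log t)) ∧
      (∀ i j : V, 0 < P i j →
        (fun t : ℕ => (TSAW.crossings (fun s => X s ω) t i j : ℝ) - t * π i * P i j)
          =O[atTop] fun t : ℕ => Real.sqrt (Real.log t)) ∧
      (∀ f : V → ℝ,
        (fun t : ℕ => |1 / (t : ℝ) * ∑ s ∈ Finset.range t, f (X s ω) - ∑ i, π i * f i|)
          =O[atTop] fun t : ℕ => Real.sqrt (Real.log t) / t)) := by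
  obtain ⟨ω₀⟩ : Nonempty Ω := MeasureTheory.nonempty_of_isProbabilityMeasure μ
  have : Nonempty V := ⟨X 0 ω₀⟩
  have hbounds := hX.eventually_bounds hP hirr hlam hπ hδ
  have hA := TSAW.vertexBound_isBigO hP hlam hδ π
  have hE := TSAW.envelope_isBigO hP hlam hδ
  refine ⟨TSAW.isUnit_laplacian_add_stationaryProjection hP hirr hπ, ?_, ?_⟩
  · filter_upwards [hbounds] with ω hω
    exact hω.mono fun t ht => ⟨ht.1, fun i j _ => ht.2.1 i j, ht.2.2⟩
  · filter_upwards [hbounds] with ω hω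
    refine ⟨fun i => ?_, fun i j _ => ?_, fun f => ?_⟩
    · refine (IsBigO.of_bound 1 (hω.mono fun t ht => ?_)).trans hA
      rw [one_mul]
      exact (ht.1 i).trans (le_abs_self _)
    · refine (IsBigO.of_bound 1 (hω.mono fun t ht => ?_)).trans
        ((hA.const_mul_left (P i j)).add (hE.const_mul_left ((TSAW.maxOutDegree P : ℝ) - 1)))
      rw [one_mul]
      exact (ht.2.1 i j).trans (le_abs_self _)
    · refine (IsBigO.of_bound (‖f‖ * Fintype.card V) (hω.mono fun t ht => ?_)).trans
        (hA.mul (isBigO_refl (fun t : ℕ => (t : ℝ)⁻¹) atTop))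
      rw [Real.norm_eq_abs, abs_abs]
      refine (ht.2.2 f).trans ((le_abs_self _).trans_eq ?_)
      rw [div_mul_eq_mul_div, mul_div_assoc, div_eq_mul_inv, abs_mul, Real.norm_eq_abs,
        abs_of_nonneg (by positivity : 0 ≤ ‖f‖ * (Fintype.card V : ℝ))]
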